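/- For a positive integer $n$ let $A(n)=\sum_{p^\nu\| n}\nu p$ and $A^*(n)=\sum_{p\mid n}p$ (sums over the primes $p$ dividing $n$, where $p^\nu\| n$ means that $p^\nu$ is the exact power of $p$ dividing $n$), and let $B(n)=A(n)-A^*(n)$. Then, uniformly for real $x\ge 2$, $$\sum_{n\le x}B(n)=x\log\log\sqrt{x}+Fx+O\left(\frac{x}{\log x}\right),$$ where $$F:=\gamma+\sum_p\left(\log\left(1-\frac1p\right)+\frac1{p-1}\right)=1.0346\ldots,$$ that is, $1.0346<F<1.0347$. Here $\gamma$ is Euler's constant, $p$ runs over all primes, and the series over the primes converges. -/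

import Mathlib

namespace AlladiErdos

/-- The function `A(n) = ∑_{p^ν ∥ n} ν p`. -/
noncomputable def A (n : ℕ) : ℝ :=
  ∑ p ∈ n.primeFactors, (n.factorization p : ℝ) * (p : ℝ)

/-- The function `A*(n) = ∑_{p ∣ n} p`. -/
noncomputable def Astar (n : ℕ) : ℝ :=
  ∑ p ∈ n.primeFactors, (p : ℝ)

/-- The function `B(n) = A(n) - A*(n)`. -/
noncomputable def B (n : ℕ) : ℝ := A n - Astar n

/-- The term `log (1 - 1/p) + 1/(p-1)` of the series over the primes. -/
noncomputable def term (p : Nat.Primes) : ℝ :=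
  Real.log (1 - 1 / ((p : ℕ) : ℝ)) + 1 / (((p : ℕ) : ℝ) - 1)

/-- The constant `F = γ + ∑_p (log (1 - 1/p) + 1/(p-1))`. -/
noncomputable def F : ℝ :=
  Real.eulerMascheroniConstant + ∑' p : Nat.Primes, term p

end AlladiErdos

open Finset Filter Topology MeasureTheory
open scoped ArithmeticFunction.vonMangoldt

namespace AlladiErdos

/-! Summing over `n ≤ x` prime by prime, each `p` contributes `p * (v_p(⌊x⌋!) - ⌊x/p⌋)`. This
vanishes for `p > √x`, and by Legendre's formula it is `x/(p-1) + O(p (log x / log p + 1))`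
otherwise. Chebyshev's bound makes the total error over `p ≤ √x` at most `O(x / log x)`, so
everything rests on the Mertens-type estimate `∑_{p ≤ y} 1/(p-1) = log log y + F + O(1/log y)` at `y
= √x`. That estimate comes from `G(t) = ∑_{k ≤ t} Λ(k)/(k log k)`. Partial summation gives `G(t) =
log log t + c + O(1/log t)` for some `c`. A Laplace transform of `G(e^u)`, compared with `log ζ(1+s)
+ log s → 0`, forces `c = γ`. Up to a small error `G` is `-∑ log(1-1/p)`, and adding the convergent
series of `term` produces `F`. For the decimals of `F`, the series is accelerated by an Euler
product for `ζ(2)`, and `γ` is read off from a harmonic number. -/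

/-! ### Mertens' theorems for the von Mangoldt function, with an unidentified constant -/

theorem log_factorial_eq_sum_vonMangoldt (n : ℕ) :
    Real.log (n.factorial : ℝ) = ∑ k ∈ Ioc 0 n, Λ k * ((n / k : ℕ) : ℝ) := by
  rw [← ArithmeticFunction.sum_Ioc_mul_zeta_eq_sum, ArithmeticFunction.vonMangoldt_mul_zeta]
  induction n with
  | zero => simp
  | succ n ih =>
    rw [Nat.factorial_succ, Nat.cast_mul, Real.log_mul (by positivity) (by positivity), ih,
      ← Finset.insert_Ioc_right_eq_Ioc_add_one (Nat.zero_le n), Finset.sum_insert (by simp),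
      ArithmeticFunction.log_apply]

/-- The partial sums of `Λ(k) / k`. -/
noncomputable def logSum (n : ℕ) : ℝ := ∑ k ∈ Ioc 0 n, Λ k / k

/-- Mertens' first theorem. -/
theorem abs_logSum_sub_log_le {n : ℕ} (hn : 1 ≤ n) :
    |logSum n - Real.log n| ≤ Real.log 4 + 4 := by
  have hn' : (0 : ℝ) < n := by exact_mod_cast hn
  have h4 : 0 ≤ Real.log 4 := Real.log_nonneg (by norm_num)
  have hlow : Real.log (n.factorial : ℝ) ≤ n * logSum n := by
    rw [log_factorial_eq_sum_vonMangoldt, logSum, mul_sum]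
    refine sum_le_sum fun k hk => ?_
    have h1 : ((n / k : ℕ) : ℝ) ≤ (n : ℝ) / k := Nat.cast_div_le
    calc Λ k * ((n / k : ℕ) : ℝ) ≤ Λ k * ((n : ℝ) / k) :=
          mul_le_mul_of_nonneg_left h1 ArithmeticFunction.vonMangoldt_nonneg
      _ = _ := by ring
  have hup : n * logSum n ≤ Real.log (n.factorial : ℝ) + Chebyshev.psi n := by
    rw [log_factorial_eq_sum_vonMangoldt, logSum, mul_sum, Chebyshev.psi, Nat.floor_natCast,
      ← sum_add_distrib]
    refine sum_le_sum fun k hk => ?_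
    have hk0 : 0 < k := (mem_Ioc.1 hk).1
    have h1 : (n : ℝ) / k ≤ ((n / k : ℕ) : ℝ) + 1 := by
      rw [div_le_iff₀ (by exact_mod_cast hk0)]
      have := Nat.lt_div_mul_add (a := n) hk0
      have h2 : (n : ℝ) < ((n / k * k + k : ℕ) : ℝ) := by exact_mod_cast this
      push_cast at h2
      linarith
    calc (n : ℝ) * (Λ k / k) = Λ k * ((n : ℝ) / k) := by ring
      _ ≤ Λ k * (((n / k : ℕ) : ℝ) + 1) :=
          mul_le_mul_of_nonneg_left h1 ArithmeticFunction.vonMangoldt_nonneg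
      _ = _ := by ring
  have hpsi := Chebyshev.psi_le_const_mul_self (x := n) hn'.le
  have hf1 : Real.log (n.factorial : ℝ) ≤ n * Real.log n := by
    rw [← Real.log_pow]
    exact Real.log_le_log (by positivity) (by exact_mod_cast Nat.factorial_le_pow n)
  have hf2 : n * Real.log n - n ≤ Real.log (n.factorial : ℝ) := by
    have := Stirling.le_log_factorial_stirling (n := n) (by omega)
    have h1 : 0 ≤ Real.log n := Real.log_nonneg (by exact_mod_cast hn)
    have h2 : 0 ≤ Real.log (2 * Real.pi) :=
      Real.log_nonneg (by linarith [Real.pi_gt_three])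
    linarith
  rw [abs_le]
  constructor
  · have : (n : ℝ) * (Real.log n - 1) ≤ n * logSum n := by linarith
    have := le_of_mul_le_mul_left this hn'
    linarith
  · have : (n : ℝ) * logSum n ≤ n * (Real.log n + (Real.log 4 + 4)) := by linarith
    have := le_of_mul_le_mul_left this hn'
    linarith

/-- The increments are dominated by those of `C * b`, so `w` is Cauchy and its distance to the limit
is at most the remaining drop of `C * b`. It serves both Mertens' second theorem and the asymptotics
of the harmonic numbers. -/
theorem exists_abs_sub_le_of_telescoping {w b : ℕ → ℝ} {C : ℝ} {m : ℕ} (hC : 0 ≤ C)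
    (hb0 : ∀ n, 0 ≤ b n) (hb : Tendsto b atTop (𝓝 0))
    (h : ∀ n, m ≤ n → |w (n + 1) - w n| ≤ C * (b n - b (n + 1))) :
    ∃ c, ∀ n, m ≤ n → |w n - c| ≤ C * b n := by
  have h1 : ∀ n, m ≤ n → ∀ k, n ≤ k → |w k - w n| ≤ C * (b n - b k) := by
    intro n hn k hk
    induction k, hk using Nat.le_induction with
    | base => simp
    | succ k hk ih =>
      calc |w (k + 1) - w n| = |(w (k + 1) - w k) + (w k - w n)| := by ring_nf
        _ ≤ |w (k + 1) - w k| + |w k - w n| := abs_add_le _ _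
        _ ≤ C * (b k - b (k + 1)) + C * (b n - b k) := add_le_add (h k (hn.trans hk)) ih
        _ = _ := by ring
  have h2 : ∀ n, m ≤ n → ∀ k, n ≤ k → |w k - w n| ≤ C * b n := fun n hn k hk =>
    (h1 n hn k hk).trans (mul_le_mul_of_nonneg_left (by linarith [hb0 k]) hC)
  have hcau : CauchySeq fun i => w (i + m) := by
    refine cauchySeq_of_le_tendsto_0' (fun i => C * b (i + m)) (fun i j hij => ?_) ?_
    · rw [dist_comm, Real.dist_eq]
      exact h2 _ (by omega) _ (by omega)
    · have := ((tendsto_add_atTop_iff_nat m).2 hb).const_mul C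
      simpa using this
  obtain ⟨c, hc⟩ := cauchySeq_tendsto_of_complete hcau
  have hc' : Tendsto w atTop (𝓝 c) := (tendsto_add_atTop_iff_nat m).1 hc
  refine ⟨c, fun n hn => ?_⟩
  have h3 : Tendsto (fun k => |w k - w n|) atTop (𝓝 |c - w n|) := (hc'.sub_const _).abs
  rw [abs_sub_comm]
  exact le_of_tendsto h3 ((eventually_ge_atTop n).mono fun k hk => h2 n hn k hk)

/-- The partial sums of `Λ(k) / (k log k)`. -/
noncomputable def primePowerSum (n : ℕ) : ℝ := ∑ k ∈ Ioc 0 n, Λ k / (k * Real.log k)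

theorem exists_abs_primePowerSum_natCast_sub_le : ∃ c K : ℝ, 0 ≤ K ∧ ∀ n : ℕ, 2 ≤ n →
    |primePowerSum n - Real.log (Real.log n) - c| ≤ K / Real.log n := by
  set C := Real.log 4 + 4 with hCdef
  have hC : 0 ≤ C := add_nonneg (Real.log_nonneg (by norm_num)) (by norm_num)
  have hlogpos : ∀ n : ℕ, 2 ≤ n → 0 < Real.log n := fun n hn =>
    Real.log_pos (by exact_mod_cast hn)
  obtain ⟨c, hc⟩ := exists_abs_sub_le_of_telescoping
    -- Partial summation in difference form: subtracting the Mertens remainder over `log n` cancels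
    -- `Λ (n + 1)` from the increment, leaving remainder times `1/log n - 1/log (n+1)` plus a
    -- second-order term.
    (w := fun n => primePowerSum n - (logSum n - Real.log n) / Real.log n - Real.log (Real.log n))
    (b := fun n => (Real.log n)⁻¹) (C := C + 1) (m := 2) (by linarith)
    (fun n => inv_nonneg.2 (Real.log_natCast_nonneg n))
    (tendsto_inv_atTop_zero.comp (Real.tendsto_log_atTop.comp tendsto_natCast_atTop_atTop)) (by
      intro n hn
      have hL := hlogpos n hn
      have hL' := hlogpos (n + 1) (by omega)
      have hR := abs_logSum_sub_log_le (n := n) (by omega)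
      have e1 : primePowerSum (n + 1) =
          primePowerSum n + Λ (n + 1) / ((n + 1 : ℕ) : ℝ) / Real.log (n + 1 : ℕ) := by
        rw [primePowerSum, ← Finset.insert_Ioc_right_eq_Ioc_add_one (Nat.zero_le n),
          Finset.sum_insert (by simp), add_comm, div_div, primePowerSum]
      have e2 : logSum (n + 1) = logSum n + Λ (n + 1) / ((n + 1 : ℕ) : ℝ) := by
        rw [logSum, ← Finset.insert_Ioc_right_eq_Ioc_add_one (Nat.zero_le n),
          Finset.sum_insert (by simp), add_comm, logSum]
      have hn0 : (0 : ℝ) < n := by positivity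
      have hd : Real.log (n + 1 : ℕ) - Real.log n ≤ 1 := by
        rw [← Real.log_div (by positivity) (by positivity)]
        refine (Real.log_le_sub_one_of_pos (by positivity)).trans ?_
        push_cast
        rw [add_div, div_self hn0.ne']
        have : (1 : ℝ) / n ≤ 1 := by
          rw [div_le_one hn0]; exact_mod_cast (by omega : 1 ≤ n)
        linarith
      have hmono : Real.log n ≤ Real.log (n + 1 : ℕ) :=
        Real.log_le_log hn0 (by push_cast; linarith)
      simp only [e1, e2]
      generalize Real.log (n + 1 : ℕ) = L' at *
      generalize Real.log n = L at *
      generalize Λ (n + 1) / ((n + 1 : ℕ) : ℝ) = g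
      generalize hRd : logSum n = M at *
      have hr : 0 < L' / L := div_pos hL' hL
      have hlog : Real.log L' - Real.log L = Real.log (L' / L) :=
        (Real.log_div hL'.ne' hL.ne').symm
      have hl1 : Real.log (L' / L) ≤ L' / L - 1 := Real.log_le_sub_one_of_pos hr
      have hl2 : 1 - (L' / L)⁻¹ ≤ Real.log (L' / L) := Real.one_sub_inv_le_log_of_pos hr
      rw [inv_div] at hl2
      have hδ : 0 ≤ L⁻¹ - L'⁻¹ := by
        rw [sub_nonneg]; exact inv_anti₀ hL hmono
      have hsq : L' / L - 1 - (1 - L / L') ≤ L⁻¹ - L'⁻¹ := by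
        have : L' / L - 1 - (1 - L / L') = (L' - L) * (L⁻¹ - L'⁻¹) := by
          field_simp
        rw [this]
        exact mul_le_of_le_one_left hδ hd
      have hmain : g / L' - ((M + g - L') / L' - (M - L) / L) - (Real.log L' - Real.log L)
          = (M - L) * (L⁻¹ - L'⁻¹) + (1 - L / L' - Real.log (L' / L)) := by
        rw [hlog]; field_simp; ring
      have : (primePowerSum n + g / L' - (M + g - L') / L' - Real.log L') -
          (primePowerSum n - (M - L) / L - Real.log L) =
          (M - L) * (L⁻¹ - L'⁻¹) + (1 - L / L' - Real.log (L' / L)) := by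
        rw [← hmain]; ring
      rw [this]
      refine (abs_add_le _ _).trans ?_
      rw [abs_mul, abs_of_nonneg hδ, add_mul, one_mul]
      refine add_le_add (mul_le_mul_of_nonneg_right hR hδ) ?_
      rw [abs_le]
      constructor <;> linarith)
  refine ⟨c, 2 * C + 1, by linarith, fun n hn => ?_⟩
  have hL := hlogpos n hn
  have h1 := hc n hn
  have hR := abs_logSum_sub_log_le (n := n) (by omega)
  have e : primePowerSum n - Real.log (Real.log n) - c =
      (primePowerSum n - (logSum n - Real.log n) / Real.log n - Real.log (Real.log n) - c) +
        (logSum n - Real.log n) / Real.log n := by ring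
  rw [e]
  refine (abs_add_le _ _).trans ?_
  rw [abs_div, abs_of_pos hL]
  calc _ ≤ (C + 1) * (Real.log n)⁻¹ + C / Real.log n :=
        add_le_add h1 (div_le_div_of_nonneg_right hR hL.le)
    _ = _ := by field_simp; ring

/-- Replacing `⌊t⌋₊` by `t` moves `log log` by at most `1 / log ⌊t⌋₊`, and `log t ≤ 2 log ⌊t⌋₊`
accounts for the factor 2. -/
theorem exists_abs_primePowerSum_floor_sub_le : ∃ c K : ℝ, 0 ≤ K ∧ ∀ t : ℝ, 2 ≤ t →
    |primePowerSum ⌊t⌋₊ - Real.log (Real.log t) - c| ≤ K / Real.log t := by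
  obtain ⟨c, K, hK, h⟩ := exists_abs_primePowerSum_natCast_sub_le
  refine ⟨c, 2 * (K + 1), by linarith, fun t ht => ?_⟩
  set n := ⌊t⌋₊ with hn
  have hn2 : 2 ≤ n := Nat.le_floor (by exact_mod_cast ht)
  have hn2' : (2 : ℝ) ≤ n := by exact_mod_cast hn2
  have hnt : (n : ℝ) ≤ t := Nat.floor_le (by linarith)
  have htn : t < n + 1 := Nat.lt_floor_add_one t
  have hL : 0 < Real.log n := Real.log_pos (by linarith)
  have hLt : 0 < Real.log t := Real.log_pos (by linarith)
  have hLL : Real.log n ≤ Real.log t := Real.log_le_log (by linarith) hnt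
  have h2 : Real.log t ≤ 2 * Real.log n := by
    have : Real.log t ≤ Real.log ((n : ℝ) ^ 2) := Real.log_le_log (by linarith) (by nlinarith)
    rwa [Real.log_pow] at this
  have h3 : Real.log t - Real.log n ≤ 1 := by
    rw [← Real.log_div (by linarith) (by linarith)]
    refine (Real.log_le_sub_one_of_pos (by positivity)).trans ?_
    rw [sub_le_iff_le_add, div_le_iff₀ (by linarith)]
    linarith
  have h4 : |Real.log (Real.log n) - Real.log (Real.log t)| ≤ 1 / Real.log n := by
    rw [abs_sub_comm, abs_of_nonneg (sub_nonneg.2 (Real.log_le_log hL hLL)),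
      ← Real.log_div hLt.ne' hL.ne']
    refine (Real.log_le_sub_one_of_pos (by positivity)).trans ?_
    rw [div_sub_one hL.ne']
    exact div_le_div_of_nonneg_right h3 hL.le
  have e : primePowerSum n - Real.log (Real.log t) - c =
    (primePowerSum n - Real.log (Real.log n) - c) +
      (Real.log (Real.log n) - Real.log (Real.log t)) := by ring
  rw [e]
  calc _ ≤ K / Real.log n + 1 / Real.log n := (abs_add_le _ _).trans (add_le_add (h n hn2) h4)
    _ = (K + 1) / Real.log n := by ring
    _ ≤ 2 * (K + 1) / Real.log t := by
      rw [div_le_div_iff₀ hL hLt]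
      nlinarith

/-! ### The constant in Mertens' second theorem is Euler's constant -/

/-- The integral is `Γ'(1)`, obtained by differentiating Euler's integral under the integral sign.
-/
theorem integral_log_mul_exp_neg :
    ∫ t in Set.Ioi (0 : ℝ), Real.log t * Real.exp (-t) = -Real.eulerMascheroniConstant := by
  have h1 := Complex.hasDerivAt_GammaIntegral (s := 1) (by simp)
  have h2 : HasDerivAt Complex.GammaIntegral (-(Real.eulerMascheroniConstant : ℂ)) 1 := by
    refine Complex.hasDerivAt_Gamma_one.congr_of_eventuallyEq ?_
    have : ∀ᶠ s : ℂ in 𝓝 1, 0 < s.re :=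
      (Complex.continuous_re.tendsto 1).eventually (lt_mem_nhds (by simp))
    filter_upwards [this] with s hs using (Complex.Gamma_eq_integral hs).symm
  have h3 := h1.unique h2
  have h4 : (∫ t : ℝ in Set.Ioi 0, (t : ℂ) ^ ((1 : ℂ) - 1) * (Real.log t * Real.exp (-t))) =
      ((∫ t in Set.Ioi (0 : ℝ), Real.log t * Real.exp (-t) : ℝ) : ℂ) := by
    rw [← integral_complex_ofReal]
    refine setIntegral_congr_fun measurableSet_Ioi fun t ht => ?_
    simp
  rw [h4] at h3
  exact_mod_cast h3

theorem integrableOn_log_mul_exp_neg :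
    IntegrableOn (fun t => Real.log t * Real.exp (-t)) (Set.Ioi (0 : ℝ)) := by
  -- A non-integrable function has integral 0 by convention, whereas the value just found is
  -- nonzero.
  by_contra h
  have h1 := integral_log_mul_exp_neg
  rw [integral_undef h] at h1
  linarith [Real.one_half_lt_eulerMascheroniConstant]

theorem integrableOn_log_mul_exp_neg_mul {s : ℝ} (hs : 0 < s) :
    IntegrableOn (fun u => Real.log u * Real.exp (-(s * u))) (Set.Ioi (0 : ℝ)) := by
  have h0 : IntegrableOn (fun t => Real.exp (-t)) (Set.Ioi (0 : ℝ)) := integrableOn_exp_neg_Ioi 0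
  have h1 : IntegrableOn (fun t => Real.log t * Real.exp (-t) - Real.log s * Real.exp (-t))
      (Set.Ioi (s * 0)) := by
    rw [mul_zero]
    exact integrableOn_log_mul_exp_neg.sub (h0.const_mul _)
  rw [← integrableOn_Ioi_comp_mul_left_iff _ _ hs] at h1
  refine h1.congr_fun (fun u hu => ?_) measurableSet_Ioi
  simp only [Real.log_mul hs.ne' (ne_of_gt hu)]
  ring

theorem integral_log_mul_exp_neg_mul {s : ℝ} (hs : 0 < s) :
    ∫ u in Set.Ioi (0 : ℝ), Real.log u * Real.exp (-(s * u)) =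
      s⁻¹ * (-Real.eulerMascheroniConstant - Real.log s) := by
  have h0 : IntegrableOn (fun t => Real.exp (-t)) (Set.Ioi (0 : ℝ)) := integrableOn_exp_neg_Ioi 0
  have h1 := integral_comp_mul_left_Ioi
    (fun t => Real.log t * Real.exp (-t) - Real.log s * Real.exp (-t)) 0 hs
  rw [mul_zero, integral_sub integrableOn_log_mul_exp_neg (h0.const_mul _),
    integral_log_mul_exp_neg, integral_const_mul, integral_exp_neg_Ioi_zero, smul_eq_mul,
    mul_one] at h1
  rw [← h1]
  refine setIntegral_congr_fun measurableSet_Ioi fun u hu => ?_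
  simp only [Real.log_mul hs.ne' (ne_of_gt hu)]
  ring

theorem primePowerSum_le_one_add_log (n : ℕ) : primePowerSum n ≤ 1 + Real.log n := by
  have h := harmonic_le_one_add_log n
  rw [harmonic_eq_sum_Icc] at h
  push_cast at h
  refine le_trans ?_ h
  rw [primePowerSum, ← Icc_add_one_left_eq_Ioc]
  refine sum_le_sum fun k hk => ?_
  have hk1 : 1 ≤ k := (mem_Icc.1 hk).1
  rcases hk1.eq_or_lt with rfl | hk1
  · simp
  · have hL : 0 < Real.log k := Real.log_pos (by exact_mod_cast hk1)
    have hk0 : (0 : ℝ) < k := by positivity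
    rw [div_le_iff₀ (by positivity), inv_mul_cancel_left₀ hk0.ne']
    exact ArithmeticFunction.vonMangoldt_le_log

/-- The Dirichlet series of `Λ(k) / (k log k)` at `s` is `log ζ(1+s)`; Abel summation and the
substitution `t = exp u` turn it into a Laplace transform. -/
theorem log_riemannZeta_eq_integral {s : ℝ} (hs : 0 < s) :
    Real.log (riemannZeta ((1 + s : ℝ) : ℂ)).re =
      s * ∫ u in Set.Ioi (0 : ℝ), primePowerSum ⌊Real.exp u⌋₊ * Real.exp (-(s * u)) := by
  set f : ℕ → ℝ := fun k => Λ k / (k * Real.log k) with hf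
  have hf0 : ∀ k, 0 ≤ f k := fun k => div_nonneg ArithmeticFunction.vonMangoldt_nonneg
    (mul_nonneg k.cast_nonneg (Real.log_natCast_nonneg k))
  have hsum : ∀ n, ∑ k ∈ Icc 1 n, f k = primePowerSum n := fun n => by
    rw [primePowerSum, ← Icc_add_one_left_eq_Ioc, zero_add]
  have hO : (fun n => ∑ k ∈ Icc 1 n, f k) =O[atTop] fun n : ℕ => (n : ℝ) ^ (s / 2) := by
    have h1 : (fun x : ℝ => 1 + Real.log x) =O[atTop] fun x : ℝ => x ^ (s / 2) := by
      refine Asymptotics.IsBigO.add ?_ (isLittleO_log_rpow_atTop (by positivity)).isBigO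
      refine Asymptotics.IsBigO.of_bound 1 ?_
      filter_upwards [eventually_ge_atTop 1] with x hx
      have := Real.one_le_rpow hx (by positivity : 0 ≤ s / 2)
      rw [Real.norm_of_nonneg (by linarith)]
      rw [one_mul]
      exact this.trans (le_abs_self _)
    refine Asymptotics.IsBigO.trans ?_ (h1.comp_tendsto tendsto_natCast_atTop_atTop)
    refine Asymptotics.IsBigO.of_bound 1 (Eventually.of_forall fun n => ?_)
    rw [hsum, one_mul, Real.norm_of_nonneg (by rw [← hsum]; exact sum_nonneg fun k _ => hf0 k)]
    exact (primePowerSum_le_one_add_log n).trans (le_abs_self _)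
  have h1 := LSeries_eq_mul_integral_of_nonneg f (r := s / 2) (s := (s : ℂ)) (by positivity)
    (by simpa using hs) hO hf0
  have h2 : LSeries (fun n => (f n : ℂ)) s =
      ((Real.log (riemannZeta ((1 + s : ℝ) : ℂ)).re : ℝ) : ℂ) := by
    rw [log_riemannZeta_eq (by linarith), LSeries_def₀ (by simp [hf]), Complex.ofReal_tsum]
    refine tsum_congr fun n => ?_
    rcases Nat.eq_zero_or_pos n with rfl | hn
    · simp [hf]
    · have hn' : (0 : ℝ) < n := by exact_mod_cast hn
      have : (n : ℂ) ^ (s : ℂ) = (((n : ℝ) ^ s : ℝ) : ℂ) := by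
        rw [Complex.ofReal_cpow hn'.le]; simp
      rw [this, ← Complex.ofReal_div, Real.rpow_add hn', Real.rpow_one, hf]
      congr 1
      simp only []
      rw [div_div]
      congr 1
      ring
  have h3 : (∫ t in Set.Ioi (1 : ℝ), (∑ k ∈ Icc 1 ⌊t⌋₊, (f k : ℂ)) * (t : ℂ) ^ (-((s : ℂ) + 1))) =
      ((∫ t in Set.Ioi (1 : ℝ), primePowerSum ⌊t⌋₊ * t ^ (-(s + 1)) : ℝ) : ℂ) := by
    rw [← integral_complex_ofReal]
    refine setIntegral_congr_fun measurableSet_Ioi fun t ht => ?_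
    have ht0 : (0 : ℝ) ≤ t := zero_le_one.trans (le_of_lt ht)
    simp only [← hsum]
    push_cast
    rw [Complex.ofReal_cpow ht0]
    push_cast
    rfl
  rw [h2, h3] at h1
  have h4 : Real.log (riemannZeta ((1 + s : ℝ) : ℂ)).re =
      s * ∫ t in Set.Ioi (1 : ℝ), primePowerSum ⌊t⌋₊ * t ^ (-(s + 1)) := by exact_mod_cast h1
  rw [h4]
  congr 1
  have himg : Real.exp '' Set.Ioi 0 = Set.Ioi 1 := by
    ext t
    constructor
    · rintro ⟨u, hu, rfl⟩
      exact Real.one_lt_exp_iff.2 hu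
    · intro ht
      exact ⟨Real.log t, Real.log_pos ht, Real.exp_log (zero_lt_one.trans ht)⟩
  rw [← himg, integral_image_eq_integral_abs_deriv_smul measurableSet_Ioi
    (fun x _ => (Real.hasDerivAt_exp x).hasDerivWithinAt) Real.exp_injective.injOn]
  refine setIntegral_congr_fun measurableSet_Ioi fun u hu => ?_
  simp only [smul_eq_mul, abs_of_pos (Real.exp_pos u)]
  rw [← Real.exp_mul, mul_left_comm, ← Real.exp_add]
  ring_nf

/-- The bound `K / u` is not integrable at 0. The power `u ^ (-1/2)` dominates it for `u ≥ log 2`,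
and dominates `|log u|` near 0, where the sum is empty of prime powers. -/
theorem exists_abs_primePowerSum_exp_sub_le {c K : ℝ} (hK : 0 ≤ K)
    (h : ∀ t : ℝ, 2 ≤ t → |primePowerSum ⌊t⌋₊ - Real.log (Real.log t) - c| ≤ K / Real.log t) :
    ∃ D : ℝ, 0 ≤ D ∧ ∀ u : ℝ, 0 < u →
      |primePowerSum ⌊Real.exp u⌋₊ - Real.log u - c| ≤ D * u ^ (-(1 / 2) : ℝ) := by
  have hl2 : 0 < Real.log 2 := Real.log_pos (by norm_num)
  refine ⟨K * (Real.log 2) ^ (-(1 / 2) : ℝ) + (2 + |c|), by positivity, fun u hu => ?_⟩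
  rcases le_or_gt (Real.log 2) u with h2 | h2
  · have h3 := h (Real.exp u) ((Real.log_le_iff_le_exp (by norm_num)).1 h2)
    rw [Real.log_exp] at h3
    refine h3.trans ?_
    have h4 : K / u = K * u ^ (-(1 / 2) : ℝ) * u ^ (-(1 / 2) : ℝ) := by
      rw [mul_assoc, ← Real.rpow_add hu]
      norm_num
      rw [Real.rpow_neg_one, div_eq_mul_inv]
    rw [h4]
    refine mul_le_mul_of_nonneg_right ?_ (by positivity)
    have h5 : u ^ (-(1 / 2) : ℝ) ≤ (Real.log 2) ^ (-(1 / 2) : ℝ) :=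
      Real.rpow_le_rpow_of_nonpos hl2 h2 (by norm_num)
    have := mul_le_mul_of_nonneg_left h5 hK
    linarith [abs_nonneg c]
  · have hu1 : u ≤ 1 := by linarith [Real.log_two_lt_d9]
    have hfl : ⌊Real.exp u⌋₊ = 1 := by
      rw [Nat.floor_eq_iff (Real.exp_pos u).le]
      have h6 : Real.exp u < 2 := by
        rw [← Real.lt_log_iff_exp_lt (by norm_num)]; exact h2
      have h7 := Real.one_le_exp hu.le
      constructor
      · simpa using h7
      · norm_num; exact h6
    have hp1 : primePowerSum 1 = 0 := by simp [primePowerSum]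
    rw [hfl, hp1, zero_sub]
    have h8 : 1 ≤ u ^ (-(1 / 2) : ℝ) := Real.one_le_rpow_of_pos_of_le_one_of_nonpos hu hu1
      (by norm_num)
    have h9 : |Real.log u| ≤ 2 * u ^ (-(1 / 2) : ℝ) := by
      rw [abs_of_nonpos (Real.log_nonpos hu.le hu1), ← Real.log_inv]
      have := Real.log_le_rpow_div (x := u⁻¹) (ε := 1 / 2) (by positivity) (by norm_num)
      rw [Real.inv_rpow hu.le, ← Real.rpow_neg hu.le] at this
      linarith
    calc |-Real.log u - c| ≤ |Real.log u| + |c| := by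
          have := abs_sub (-Real.log u) c
          rwa [abs_neg] at this
      _ ≤ 2 * u ^ (-(1 / 2) : ℝ) + |c| * u ^ (-(1 / 2) : ℝ) :=
          add_le_add h9 (le_mul_of_one_le_right (abs_nonneg c) h8)
      _ = (2 + |c|) * u ^ (-(1 / 2) : ℝ) := by ring
      _ ≤ _ := mul_le_mul_of_nonneg_right
          (le_add_of_nonneg_left (by positivity)) (by positivity)

/-- Split the Laplace transform into `log u`, `c` and the error; the first two give `-γ - log s +
c`, and the error costs `s * ∫ u^(-1/2) e^(-su) = Γ(1/2) s^(1/2)`. -/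
theorem abs_log_riemannZeta_sub_le {c D s : ℝ} (hs : 0 < s)
    (h : ∀ u : ℝ, 0 < u →
      |primePowerSum ⌊Real.exp u⌋₊ - Real.log u - c| ≤ D * u ^ (-(1 / 2) : ℝ)) :
    |Real.log (riemannZeta ((1 + s : ℝ) : ℂ)).re + Real.log s
      - (c - Real.eulerMascheroniConstant)| ≤ D * Real.Gamma (1 / 2) * s ^ (1 / 2 : ℝ) := by
  set E : ℝ → ℝ := fun u => primePowerSum ⌊Real.exp u⌋₊ - Real.log u - c with hE
  have hmono : Monotone fun u : ℝ => primePowerSum ⌊Real.exp u⌋₊ := by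
    intro a b hab
    refine sum_le_sum_of_subset_of_nonneg
      (Ioc_subset_Ioc_right (Nat.floor_le_floor (Real.exp_le_exp.2 hab))) fun k _ _ => ?_
    exact div_nonneg ArithmeticFunction.vonMangoldt_nonneg
      (mul_nonneg k.cast_nonneg (Real.log_natCast_nonneg k))
  have hEm : Measurable E :=
    (hmono.measurable.sub Real.measurable_log).sub measurable_const
  have hdomint := Real.integral_rpow_mul_exp_neg_mul_Ioi (a := 1 / 2) (r := s) (by norm_num) hs
  have hdom : IntegrableOn (fun u : ℝ => u ^ (1 / 2 - 1 : ℝ) * Real.exp (-(s * u)))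
      (Set.Ioi 0) := by
    by_contra hc
    rw [integral_undef hc] at hdomint
    have : 0 < (1 / s) ^ (1 / 2 : ℝ) * Real.Gamma (1 / 2) :=
      mul_pos (by positivity) (Real.Gamma_pos_of_pos (by norm_num))
    linarith
  have hbound : ∀ u ∈ Set.Ioi (0 : ℝ), ‖E u * Real.exp (-(s * u))‖ ≤
      D * (u ^ (1 / 2 - 1 : ℝ) * Real.exp (-(s * u))) := by
    intro u hu
    rw [norm_mul, Real.norm_of_nonneg (Real.exp_pos _).le, ← mul_assoc]
    refine mul_le_mul_of_nonneg_right ?_ (Real.exp_pos _).le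
    have := h u hu
    norm_num at this ⊢
    exact this
  have hEint : IntegrableOn (fun u => E u * Real.exp (-(s * u))) (Set.Ioi 0) := by
    refine Integrable.mono' (hdom.const_mul D) ?_ ?_
    · exact (hEm.mul (by fun_prop)).aestronglyMeasurable
    · exact (ae_restrict_iff' measurableSet_Ioi).2 (Eventually.of_forall hbound)
  have hEle : |∫ u in Set.Ioi (0 : ℝ), E u * Real.exp (-(s * u))| ≤
      D * ((1 / s) ^ (1 / 2 : ℝ) * Real.Gamma (1 / 2)) := by
    rw [← hdomint, ← integral_const_mul]
    exact norm_integral_le_of_norm_le (hdom.const_mul D)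
      ((ae_restrict_iff' measurableSet_Ioi).2 (Eventually.of_forall hbound))
  have hexp : IntegrableOn (fun u => c * Real.exp (-(s * u))) (Set.Ioi (0 : ℝ)) := by
    have := (integrableOn_exp_mul_Ioi (a := -s) (by linarith) 0).const_mul c
    simp only [neg_mul] at this
    exact this
  have hexpint : ∫ u in Set.Ioi (0 : ℝ), c * Real.exp (-(s * u)) = c * s⁻¹ := by
    rw [integral_const_mul]
    have := integral_exp_mul_Ioi (a := -s) (by linarith) 0
    simp only [neg_mul, mul_zero, Real.exp_zero] at this
    rw [this]
    field_simp
  have hsplit : ∫ u in Set.Ioi (0 : ℝ), primePowerSum ⌊Real.exp u⌋₊ * Real.exp (-(s * u)) =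
      (∫ u in Set.Ioi (0 : ℝ), E u * Real.exp (-(s * u))) +
        s⁻¹ * (-Real.eulerMascheroniConstant - Real.log s) + c * s⁻¹ := by
    rw [← hexpint, ← integral_log_mul_exp_neg_mul hs,
      ← integral_add hEint (integrableOn_log_mul_exp_neg_mul hs)]
    refine Eq.trans ?_ (integral_add (hEint.add (integrableOn_log_mul_exp_neg_mul hs)) hexp)
    refine setIntegral_congr_fun measurableSet_Ioi fun u _ => ?_
    simp only [hE]
    ring
  rw [log_riemannZeta_eq_integral hs, hsplit]
  generalize (∫ u in Set.Ioi (0 : ℝ), E u * Real.exp (-(s * u))) = I at *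
  have e : s * (I + s⁻¹ * (-Real.eulerMascheroniConstant - Real.log s) + c * s⁻¹) + Real.log s
      - (c - Real.eulerMascheroniConstant) = s * I := by
    field_simp
    ring
  rw [e, abs_mul, abs_of_pos hs]
  calc s * |I| ≤ s * (D * ((1 / s) ^ (1 / 2 : ℝ) * Real.Gamma (1 / 2))) :=
        mul_le_mul_of_nonneg_left hEle hs.le
    _ = D * Real.Gamma (1 / 2) * (s * (1 / s) ^ (1 / 2 : ℝ)) := by ring
    _ = _ := by
      congr 1
      rw [one_div s, Real.inv_rpow hs.le, ← Real.rpow_neg hs.le]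
      nth_rewrite 1 [← Real.rpow_one s]
      rw [← Real.rpow_add hs]
      norm_num

/-- Mertens' second theorem for prime powers, with Euler's constant as the constant term. -/
theorem exists_abs_primePowerSum_floor_sub_eulerMascheroni_le : ∃ K : ℝ, 0 ≤ K ∧ ∀ t : ℝ, 2 ≤ t →
    |primePowerSum ⌊t⌋₊ - Real.log (Real.log t) - Real.eulerMascheroniConstant| ≤
      K / Real.log t := by
  obtain ⟨c, K, hK, h⟩ := exists_abs_primePowerSum_floor_sub_le
  obtain ⟨D, hD, hDb⟩ := exists_abs_primePowerSum_exp_sub_le hK h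
  -- As `s → 0+`, `log ζ(1+s) + log s` tends to 0 because of the simple pole with residue 1, and to
  -- `c - γ` by the Laplace transform.
  suffices hc : c = Real.eulerMascheroniConstant from ⟨K, hK, hc ▸ h⟩
  have hshift : Tendsto (fun s : ℝ => 1 + s) (𝓝[>] 0) (𝓝[>] 1) := by
    refine tendsto_nhdsWithin_iff.2 ⟨?_, ?_⟩
    · have : Tendsto (fun s : ℝ => 1 + s) (𝓝 0) (𝓝 (1 + 0)) :=
        (continuous_const.add continuous_id).tendsto 0
      rw [add_zero] at this
      exact this.mono_left nhdsWithin_le_nhds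
    · filter_upwards [self_mem_nhdsWithin] with s hs
      simpa using hs
  have hz : Tendsto (fun s : ℝ => Real.log (riemannZeta ((1 + s : ℝ) : ℂ)).re + Real.log s)
      (𝓝[>] 0) (𝓝 0) := by
    have h1 := (Asymptotics.isLittleO_one_iff ℝ).1 log_riemannZeta_add_log_sub_isLittleO_ofReal
    have h2 := h1.comp hshift
    refine h2.congr fun s => ?_
    simp
  have hz' : Tendsto (fun s : ℝ => Real.log (riemannZeta ((1 + s : ℝ) : ℂ)).re + Real.log s)
      (𝓝[>] 0) (𝓝 (c - Real.eulerMascheroniConstant)) := by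
    rw [tendsto_iff_norm_sub_tendsto_zero]
    refine squeeze_zero' (Eventually.of_forall fun _ => norm_nonneg _)
      (g := fun s : ℝ => D * Real.Gamma (1 / 2) * s ^ (1 / 2 : ℝ)) ?_ ?_
    · filter_upwards [self_mem_nhdsWithin] with s hs
      exact abs_log_riemannZeta_sub_le hs hDb
    · have : Tendsto (fun s : ℝ => D * Real.Gamma (1 / 2) * s ^ (1 / 2 : ℝ)) (𝓝 0)
          (𝓝 (D * Real.Gamma (1 / 2) * 0 ^ (1 / 2 : ℝ))) :=
        ((Real.continuous_rpow_const (by norm_num)).tendsto 0).const_mul _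
      rw [Real.zero_rpow (by norm_num), mul_zero] at this
      exact this.mono_left nhdsWithin_le_nhds
  have := tendsto_nhds_unique hz hz'
  linarith

/-! ### From prime powers to the sum of `1 / (p - 1)` over primes -/

theorem primePowerSum_eq_sum_primesLE (n : ℕ) :
    primePowerSum n = ∑ p ∈ Nat.primesLE n, ∑ k ∈ Icc 1 (Nat.log p n), 1 / (k * (p : ℝ) ^ k) := by
  have himg : ∑ m ∈ ((Icc 1 n).filter Nat.Prime).biUnion
      (fun p => image (p ^ ·) (Icc 1 (Nat.log p n))), Λ m / (m * Real.log m) = primePowerSum n := by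
    rw [primePowerSum, ← Icc_add_one_left_eq_Ioc, zero_add]
    refine sum_subset (fun q hq => ?_) fun x hx => ?_
    · simp only [mem_biUnion, mem_filter, mem_Icc, mem_image] at hq ⊢
      obtain ⟨p, ⟨⟨hp1, hpn⟩, hp⟩, k, ⟨_, hk⟩, rfl⟩ := hq
      exact ⟨Nat.one_le_pow _ _ hp1, Nat.pow_le_of_le_log (by omega) hk⟩
    · simp only [mem_biUnion, mem_filter, mem_Icc, mem_image, not_exists, not_and, and_imp]
      intro h
      rw [div_eq_zero_iff, ArithmeticFunction.vonMangoldt_eq_zero_iff, isPrimePow_nat_iff]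
      left
      rintro ⟨p, k, hp, hk, rfl⟩
      simp only [mem_Icc] at hx
      have hpn : p ≤ n := (Nat.le_of_dvd (by omega) (dvd_pow_self p hk.ne')).trans hx.2
      exact h p hp.one_le hpn hp k (by omega) (Nat.le_log_of_pow_le hp.one_lt hx.2) rfl
  rw [← himg, sum_biUnion, Nat.primesLE_eq_filter_Icc_one]
  · refine sum_congr rfl fun p hp => ?_
    have hpp : p.Prime := (mem_filter.1 hp).2
    rw [sum_image fun a _ b _ hab => Nat.pow_right_injective hpp.two_le hab]
    refine sum_congr rfl fun k hk => ?_
    have hk0 : k ≠ 0 := by have := (mem_Icc.1 hk).1; omega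
    have hL : 0 < Real.log p := Real.log_pos (by exact_mod_cast hpp.one_lt)
    have hp0 : (0 : ℝ) < p := by exact_mod_cast hpp.pos
    have hk0' : (k : ℝ) ≠ 0 := by exact_mod_cast hk0
    rw [ArithmeticFunction.vonMangoldt_apply_pow hk0,
      ArithmeticFunction.vonMangoldt_apply_prime hpp]
    push_cast
    rw [Real.log_pow]
    field_simp
  · intro p hp q hq hpq
    have hpp : p.Prime := (mem_filter.1 hp).2
    have hqq : q.Prime := (mem_filter.1 hq).2
    refine disjoint_left.2 fun m hm hm' => hpq ?_
    simp only [mem_image, mem_Icc] at hm hm'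
    obtain ⟨a, ha, rfl⟩ := hm
    obtain ⟨b, hb, hab⟩ := hm'
    have h1 : p ∣ q ^ b := hab ▸ dvd_pow_self p (by omega)
    exact (Nat.prime_dvd_prime_iff_eq hpp hqq).1 (hpp.dvd_of_dvd_pow h1)

theorem abs_neg_log_one_sub_inv_sub_sum_le {p n : ℕ} (hp : p.Prime) (hpn : p ≤ n) :
    |-Real.log (1 - 1 / p) - ∑ k ∈ Icc 1 (Nat.log p n), 1 / (k * (p : ℝ) ^ k)| ≤
      2 / √n * (p : ℝ)⁻¹ := by
  have hp0 : (0 : ℝ) < p := by exact_mod_cast hp.pos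
  have hp2 : (2 : ℝ) ≤ p := by exact_mod_cast hp.two_le
  have hn0 : (0 : ℝ) < n := by exact_mod_cast hp.pos.trans_le hpn
  have hx : 1 / (p : ℝ) ≤ 1 / 2 := one_div_le_one_div_of_le (by norm_num) hp2
  have hx0 : 0 < 1 / (p : ℝ) := by positivity
  have habs : |1 / (p : ℝ)| = 1 / p := abs_of_pos hx0
  set K := Nat.log p n with hK
  have h := Real.abs_log_sub_add_sum_range_le (x := 1 / p) (by rw [habs]; linarith) K
  have hs : ∑ k ∈ Icc 1 K, 1 / (k * (p : ℝ) ^ k) =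
      ∑ i ∈ range K, (1 / (p : ℝ)) ^ (i + 1) / (i + 1) := by
    rw [← Ico_add_one_right_eq_Icc, sum_Ico_eq_sum_range]
    refine sum_congr (by simp) fun i _ => ?_
    push_cast
    rw [add_comm 1 i, add_comm (1 : ℝ), one_div_pow]
    field_simp
  rw [hs, ← abs_neg]
  have e : -(-Real.log (1 - 1 / p) - ∑ i ∈ range K, (1 / (p : ℝ)) ^ (i + 1) / (i + 1)) =
    ∑ i ∈ range K, (1 / (p : ℝ)) ^ (i + 1) / (i + 1) + Real.log (1 - 1 / p) := by ring
  rw [e]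
  refine h.trans ?_
  rw [habs]
  -- `p ^ (K + 1)` exceeds both `n` and `p ^ 2`, or equals the latter, hence is at least their
  -- geometric mean. Keeping the factor `1/p` lets the errors be summed harmonically.
  have hpow : √n * p ≤ (p : ℝ) ^ (K + 1) := by
    have h1 : (n : ℝ) ≤ (p : ℝ) ^ (K + 1) := by
      exact_mod_cast (Nat.lt_pow_succ_log_self hp.one_lt n).le
    have hK1 : 1 ≤ K := Nat.log_pos hp.one_lt hpn
    have h2 : (p : ℝ) ^ 2 ≤ (p : ℝ) ^ (K + 1) :=
      pow_le_pow_right₀ (by linarith) (by omega)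
    refine (pow_le_pow_iff_left₀ (by positivity) (by positivity) two_ne_zero).1 ?_
    rw [mul_pow, Real.sq_sqrt hn0.le, sq ((p : ℝ) ^ (K + 1))]
    exact mul_le_mul h1 h2 (by positivity) (by positivity)
  have hs0 : 0 < √(n : ℝ) := Real.sqrt_pos.2 hn0
  calc (1 / (p : ℝ)) ^ (K + 1) / (1 - 1 / p) ≤ (1 / (p : ℝ)) ^ (K + 1) / (1 / 2) :=
        div_le_div_of_nonneg_left (by positivity) (by norm_num) (by linarith)
    _ = 2 * (1 / (p : ℝ) ^ (K + 1)) := by rw [one_div_pow]; ring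
    _ ≤ 2 * (1 / (√n * p)) := by
        have := one_div_le_one_div_of_le (by positivity) hpow
        linarith
    _ = _ := by field_simp

theorem log_sq_le {y : ℝ} (hy : 1 ≤ y) : (Real.log y) ^ 2 ≤ 16 * √y := by
  have h0 : 0 ≤ Real.log y := Real.log_nonneg hy
  have h1 := Real.log_le_rpow_div (x := y) (ε := 1 / 4) (by linarith) (by norm_num)
  have h2 : (y ^ (1 / 4 : ℝ)) ^ 2 = √y := by
    rw [← Real.rpow_natCast, ← Real.rpow_mul (by linarith), Real.sqrt_eq_rpow]
    norm_num
  calc (Real.log y) ^ 2 ≤ (y ^ (1 / 4 : ℝ) / (1 / 4)) ^ 2 := pow_le_pow_left₀ h0 h1 2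
    _ = 16 * (y ^ (1 / 4 : ℝ)) ^ 2 := by ring
    _ = _ := by rw [h2]

theorem abs_sum_neg_log_sub_primePowerSum_le {n : ℕ} (hn : 2 ≤ n) :
    |∑ p ∈ Nat.primesLE n, -Real.log (1 - 1 / p) - primePowerSum n| ≤ 96 / Real.log n := by
  have hn2 : (2 : ℝ) ≤ n := by exact_mod_cast hn
  have hL : 1 / 2 ≤ Real.log n := by
    have := Real.log_le_log (by norm_num) hn2
    linarith [Real.log_two_gt_d9]
  have hs0 : 0 < √(n : ℝ) := Real.sqrt_pos.2 (by linarith)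
  rw [primePowerSum_eq_sum_primesLE, ← sum_sub_distrib]
  have hharm : ∑ p ∈ Nat.primesLE n, (p : ℝ)⁻¹ ≤ 1 + Real.log n := by
    have h := harmonic_le_one_add_log n
    rw [harmonic_eq_sum_Icc] at h
    push_cast at h
    refine le_trans ?_ h
    rw [Nat.primesLE_eq_filter_Icc_one]
    exact sum_le_sum_of_subset_of_nonneg (filter_subset _ _) fun k _ _ => by positivity
  calc _ ≤ ∑ p ∈ Nat.primesLE n, 2 / √n * (p : ℝ)⁻¹ := by
        refine (abs_sum_le_sum_abs _ _).trans (sum_le_sum fun p hp => ?_)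
        exact abs_neg_log_one_sub_inv_sub_sum_le (Nat.prime_of_mem_primesLE hp)
          (Nat.le_of_mem_primesLE hp)
    _ = 2 / √n * ∑ p ∈ Nat.primesLE n, (p : ℝ)⁻¹ := by rw [mul_sum]
    _ ≤ 2 / √n * (1 + Real.log n) := mul_le_mul_of_nonneg_left hharm (by positivity)
    _ ≤ 96 / Real.log n := by
        have h1 := log_sq_le (y := n) (by linarith)
        rw [div_mul_eq_mul_div, div_le_div_iff₀ hs0 (by linarith)]
        nlinarith

/-- The tail over primes is compared with a telescoping sum over all integers, composites only
adding nonnegative drops of `b`. -/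
theorem summable_primes_and_tsum_bounds {g b : ℕ → ℝ} {n : ℕ} (hb0 : ∀ m, 0 ≤ b m)
    (hanti : ∀ m, n ≤ m → b (m + 1) ≤ b m)
    (h : ∀ m, n ≤ m → (m + 1).Prime → 0 ≤ g (m + 1) ∧ g (m + 1) ≤ b m - b (m + 1)) :
    Summable (fun p : Nat.Primes => g p) ∧
      ∑ p ∈ Nat.primesLE n, g p ≤ ∑' p : Nat.Primes, g p ∧
      ∑' p : Nat.Primes, g p ≤ ∑ p ∈ Nat.primesLE n, g p + b n := by
  set f : ℕ → ℝ := Set.indicator {p | p.Prime} g with hf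
  have hf0 : ∀ k, 0 ≤ f (k + (n + 1)) := fun k => by
    rw [hf, Set.indicator_apply]
    split_ifs with hp
    · exact (h (k + n) (by omega) hp).1
    · exact le_rfl
  have hfb : ∀ k, f (k + (n + 1)) ≤ b (k + n) - b (k + 1 + n) := fun k => by
    rw [hf, Set.indicator_apply, show k + 1 + n = k + n + 1 by ring]
    split_ifs with hp
    · exact (h (k + n) (by omega) hp).2
    · linarith [hanti (k + n) (by omega)]
  have hpart : ∀ m, ∑ k ∈ range m, f (k + (n + 1)) ≤ b n := fun m => by
    calc _ ≤ ∑ k ∈ range m, (b (k + n) - b (k + 1 + n)) := sum_le_sum fun k _ => hfb k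
      _ = b (0 + n) - b (m + n) := sum_range_sub' (fun k => b (k + n)) m
      _ ≤ b n := by rw [zero_add]; linarith [hb0 (m + n)]
  have hsum' : Summable fun k => f (k + (n + 1)) := summable_of_sum_range_le hf0 hpart
  have hsum : Summable f := (summable_nat_add_iff (n + 1)).1 hsum'
  have htsum : ∑' p : Nat.Primes, g p = ∑' k, f k := tsum_subtype {p : ℕ | p.Prime} g
  have hfin : ∑ k ∈ range (n + 1), f k = ∑ p ∈ Nat.primesLE n, g p := by
    rw [Nat.primesLE_eq_filter_range, sum_filter]
    exact sum_congr rfl fun k _ => by simp [hf, Set.indicator_apply]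
  rw [htsum, ← hsum.sum_add_tsum_nat_add (n + 1), hfin]
  refine ⟨summable_subtype_iff_indicator.2 hsum, ?_, ?_⟩
  · exact le_add_of_nonneg_right (tsum_nonneg hf0)
  · linarith [Real.tsum_le_of_sum_range_le hf0 hpart]

/-- The function on `ℕ` whose values at the primes are given by `term`. -/
noncomputable def natTerm (n : ℕ) : ℝ := Real.log (1 - 1 / n) + 1 / ((n : ℝ) - 1)

theorem natTerm_bounds {m : ℕ} (hm : 1 ≤ m) :
    0 ≤ natTerm (m + 1) ∧ natTerm (m + 1) ≤ (m : ℝ)⁻¹ - ((m + 1 : ℕ) : ℝ)⁻¹ := by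
  have hm0 : (0 : ℝ) < m := by exact_mod_cast hm
  have e : 1 - 1 / ((m + 1 : ℕ) : ℝ) = m / (m + 1) := by
    push_cast; field_simp; ring
  have h1 := Real.log_le_sub_one_of_pos (x := (m : ℝ) / (m + 1)) (by positivity)
  have h2 := Real.one_sub_inv_le_log_of_pos (x := (m : ℝ) / (m + 1)) (by positivity)
  rw [natTerm, e]
  push_cast
  rw [add_sub_cancel_right]
  constructor
  · have : 1 - ((m : ℝ) / (m + 1))⁻¹ + 1 / m = 0 := by field_simp; ring
    linarith
  · have : (m : ℝ) / (m + 1) - 1 = -((m : ℝ) + 1)⁻¹ := by field_simp; ring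
    rw [one_div]
    linarith

theorem summable_term_and_tsum_bounds {n : ℕ} (hn : 1 ≤ n) :
    Summable term ∧ ∑ p ∈ Nat.primesLE n, natTerm p ≤ ∑' p, term p ∧
      ∑' p, term p ≤ ∑ p ∈ Nat.primesLE n, natTerm p + (n : ℝ)⁻¹ :=
  summable_primes_and_tsum_bounds (g := natTerm) (b := fun m => (m : ℝ)⁻¹)
    (fun m => by positivity)
    (fun m hm => inv_anti₀ (by exact_mod_cast hn.trans hm) (by push_cast; linarith))
    fun _ hm _ => natTerm_bounds (hn.trans hm)

/-- Mertens' theorem for the sum of `1 / (p - 1)`. -/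
theorem exists_abs_sum_one_div_prime_sub_one_sub_le : ∃ K : ℝ, 0 ≤ K ∧ ∀ y : ℝ, 1 < y →
    |∑ p ∈ Nat.primesLE ⌊y⌋₊, 1 / ((p : ℝ) - 1) - (Real.log (Real.log y) + F)| ≤
      K / Real.log y := by
  obtain ⟨K, hK, h⟩ := exists_abs_primePowerSum_floor_sub_eulerMascheroni_le
  -- `K` comes from Mertens, `192 = 2 * 96` from passing to logarithms, `2` from the tail of `term`.
  -- The summand `1 + |F|` covers `1 < y < 2`, where the prime sum is empty; this range is needed
  -- since `y = √x` may be below 2.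
  refine ⟨K + 194 + (1 + |F|), by positivity, fun y hy => ?_⟩
  have hLy : 0 < Real.log y := Real.log_pos hy
  rcases le_or_gt 2 y with hy2 | hy2
  · set n := ⌊y⌋₊ with hn
    have hn2 : 2 ≤ n := Nat.le_floor (by exact_mod_cast hy2)
    have hn2' : (2 : ℝ) ≤ n := by exact_mod_cast hn2
    have hyn : y < n + 1 := Nat.lt_floor_add_one y
    have hL : 0 < Real.log n := Real.log_pos (by linarith)
    have h2 : Real.log y ≤ 2 * Real.log n := by
      have : Real.log y ≤ Real.log ((n : ℝ) ^ 2) := Real.log_le_log (by linarith) (by nlinarith)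
      rwa [Real.log_pow] at this
    have hinv : 1 / Real.log n ≤ 2 / Real.log y := by
      rw [div_le_div_iff₀ hL hLy]; linarith
    have hninv : (n : ℝ)⁻¹ ≤ 1 / Real.log n := by
      rw [inv_eq_one_div]
      exact one_div_le_one_div_of_le hL (Real.log_le_self (by linarith))
    obtain ⟨-, ht1, ht2⟩ := summable_term_and_tsum_bounds (n := n) (by omega)
    have hG := h y hy2
    have hlog := abs_sum_neg_log_sub_primePowerSum_le hn2
    have hsplit : ∑ p ∈ Nat.primesLE n, 1 / ((p : ℝ) - 1) =
        ∑ p ∈ Nat.primesLE n, natTerm p + ∑ p ∈ Nat.primesLE n, -Real.log (1 - 1 / p) := by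
      rw [← sum_add_distrib]
      refine sum_congr rfl fun p _ => ?_
      rw [natTerm]; ring
    have h96 : 96 / Real.log n ≤ 192 / Real.log y := by
      rw [div_le_div_iff₀ hL hLy]; linarith
    have hF : F = Real.eulerMascheroniConstant + ∑' p, term p := rfl
    have hexp : (K + 194 + (1 + |F|)) / Real.log y =
      K / Real.log y + 192 / Real.log y + 2 / Real.log y + (1 + |F|) / Real.log y := by ring
    have hpos : 0 ≤ (1 + |F|) / Real.log y := by positivity
    rw [hsplit, hexp]
    rw [hF] at *
    rw [abs_le] at *
    constructor <;> linarith
  · have hfl : ⌊y⌋₊ = 1 := by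
      rw [Nat.floor_eq_iff (by linarith)]
      exact ⟨by simpa using hy.le, by norm_num; exact hy2⟩
    have hL1 : Real.log y ≤ 1 := by
      have := Real.log_le_log (by linarith) hy2.le
      linarith [Real.log_two_lt_d9]
    rw [hfl, Nat.primesLE_one, sum_empty, zero_sub, abs_neg, le_div_iff₀ hLy]
    have h1 : |Real.log (Real.log y)| * Real.log y ≤ 1 := by
      rw [abs_of_nonpos (Real.log_nonpos hLy.le hL1)]
      have h2 := Real.one_sub_inv_le_log_of_pos hLy
      have h3 : -Real.log (Real.log y) ≤ (Real.log y)⁻¹ := by linarith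
      calc _ ≤ (Real.log y)⁻¹ * Real.log y := mul_le_mul_of_nonneg_right h3 hLy.le
        _ = 1 := inv_mul_cancel₀ hLy.ne'
    have h4 : |F| * Real.log y ≤ |F| := mul_le_of_le_one_right (abs_nonneg _) hL1
    have h5 := mul_le_mul_of_nonneg_right (abs_add_le (Real.log (Real.log y)) F) hLy.le
    linarith

/-! ### The summatory function of `B` -/

theorem A_eq_sum_primesLE {n N : ℕ} (hn : n ∈ Icc 1 N) :
    A n = ∑ p ∈ Nat.primesLE N, (n.factorization p : ℝ) * p := by
  obtain ⟨h1, h2⟩ := mem_Icc.1 hn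
  refine sum_subset (fun p hp => ?_) fun p _ hp => ?_
  · exact Nat.mem_primesLE.2 ⟨(Nat.le_of_mem_primeFactors hp).trans h2,
      Nat.prime_of_mem_primeFactors hp⟩
  · rw [← Nat.support_factorization, Finsupp.notMem_support_iff] at hp
    simp [hp]

theorem Astar_eq_sum_primesLE {n N : ℕ} (hn : n ∈ Icc 1 N) :
    Astar n = ∑ p ∈ Nat.primesLE N, if p ∣ n then (p : ℝ) else 0 := by
  obtain ⟨h1, h2⟩ := mem_Icc.1 hn
  rw [Astar, ← sum_filter]
  refine sum_congr ?_ fun _ _ => rfl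
  ext p
  rw [mem_filter, Nat.mem_primesLE, Nat.mem_primeFactors]
  constructor
  · rintro ⟨hp, hd, _⟩
    exact ⟨⟨(Nat.le_of_dvd h1 hd).trans h2, hp⟩, hd⟩
  · rintro ⟨⟨_, hp⟩, hd⟩
    exact ⟨hp, hd, by omega⟩

theorem sum_factorization_eq_factorization_factorial (p N : ℕ) :
    ∑ n ∈ Icc 1 N, n.factorization p = N.factorial.factorization p := by
  induction N with
  | zero => simp
  | succ N ih =>
    rw [sum_Icc_succ_top (by omega), ih, Nat.factorial_succ,
      Nat.factorization_mul (by omega) (Nat.factorial_ne_zero N), Finsupp.add_apply, add_comm]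

theorem sum_B_eq_sum_primesLE (N : ℕ) :
    ∑ n ∈ Icc 1 N, B n = ∑ p ∈ Nat.primesLE N,
      (p : ℝ) * ((N.factorial.factorization p : ℝ) - ((N / p : ℕ) : ℝ)) := by
  have h1 : ∀ n ∈ Icc 1 N, B n = ∑ p ∈ Nat.primesLE N,
      ((n.factorization p : ℝ) * p - if p ∣ n then (p : ℝ) else 0) := fun n hn => by
    rw [B, A_eq_sum_primesLE hn, Astar_eq_sum_primesLE hn, sum_sub_distrib]
  rw [sum_congr rfl h1, sum_comm]
  refine sum_congr rfl fun p _ => ?_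
  rw [sum_sub_distrib, ← sum_mul, ← sum_filter, sum_const, nsmul_eq_mul,
    ← Nat.Ioc_filter_dvd_card_eq_div, ← sum_factorization_eq_factorization_factorial,
    ← Icc_add_one_left_eq_Ioc, zero_add]
  push_cast
  ring

theorem factorization_factorial_eq_div {p N : ℕ} (hp : p.Prime) (h : N < p ^ 2) :
    N.factorial.factorization p = N / p := by
  rw [Nat.factorization_factorial hp (b := 2) (Nat.log_lt_of_lt_pow' (by norm_num) h)]
  simp

/-- Legendre's digit formula `(p-1) v_p(N!) = N - s_p(N)`, with the digit sum at most `(p-1)(log_p N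
+ 1)`. The other errors are the remainder of `N` modulo `p` and the fractional part of `x`. -/
theorem abs_factorization_factorial_sub_le {x : ℝ} {p : ℕ} (hx : 1 ≤ x) (hp : p.Prime) :
    |(p : ℝ) * ((⌊x⌋₊.factorial.factorization p : ℝ) - ((⌊x⌋₊ / p : ℕ) : ℝ)) -
      x / ((p : ℝ) - 1)| ≤ p * (Real.log x / Real.log p + 2) := by
  set N := ⌊x⌋₊ with hN
  have hp2 : (2 : ℝ) ≤ p := by exact_mod_cast hp.two_le
  have hN1 : 1 ≤ N := Nat.le_floor (by exact_mod_cast hx)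
  have hNx : (N : ℝ) ≤ x := Nat.floor_le (by linarith)
  have hxN : x < N + 1 := Nat.lt_floor_add_one x
  have hlp : 0 < Real.log p := Real.log_pos (by linarith)
  have hN0 : (0 : ℝ) < N := by exact_mod_cast hN1
  have hleg := Nat.sub_one_mul_factorization_factorial (n := N) hp
  have hle : (p.digits N).sum ≤ N := Nat.digit_sum_le p N
  set v := N.factorial.factorization p
  set s := (p.digits N).sum with hs
  have hleg' : ((p : ℝ) - 1) * v = N - s := by
    have : (((p - 1) * v : ℕ) : ℝ) = ((N - s : ℕ) : ℝ) := by rw [hleg]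
    rw [Nat.cast_mul, Nat.cast_sub hp.one_le, Nat.cast_sub hle, Nat.cast_one] at this
    exact this
  have hs1 : s ≤ (Nat.log p N + 1) * (p - 1) := by
    rw [← Nat.length_digits p N hp.one_lt (by omega), ← smul_eq_mul]
    exact List.sum_le_card_nsmul _ _ fun d hd => Nat.le_sub_one_of_lt
      (Nat.digits_lt_base hp.one_lt hd)
  have hlog : (Nat.log p N : ℝ) ≤ Real.log x / Real.log p := by
    rw [le_div_iff₀ hlp, ← Real.log_pow]
    refine Real.log_le_log (by positivity) ?_
    refine le_trans ?_ hNx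
    exact_mod_cast Nat.pow_log_le_self p (by omega)
  have hs2 : (s : ℝ) ≤ (Real.log x / Real.log p + 1) * (p - 1) := by
    have : (s : ℝ) ≤ (((Nat.log p N + 1) * (p - 1) : ℕ) : ℝ) := by exact_mod_cast hs1
    rw [Nat.cast_mul, Nat.cast_sub hp.one_le] at this
    push_cast at this
    exact this.trans (mul_le_mul_of_nonneg_right (by linarith) (by linarith))
  have hdiv1 : (p : ℝ) * ((N / p : ℕ) : ℝ) ≤ N := by exact_mod_cast Nat.mul_div_le N p
  have hdiv2 : (N : ℝ) < (p : ℝ) * ((N / p : ℕ) : ℝ) + p := by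
    have := Nat.lt_div_mul_add (a := N) hp.pos
    have h2 : (N : ℝ) < ((N / p * p + p : ℕ) : ℝ) := by exact_mod_cast this
    push_cast at h2
    linarith
  have hp1 : (0 : ℝ) < p - 1 := by linarith
  have hv : (v : ℝ) = (N - s) / (p - 1) := by
    rw [eq_div_iff hp1.ne', mul_comm]; exact hleg'
  have e : (p : ℝ) * (v - ((N / p : ℕ) : ℝ)) - x / (p - 1) =
      (N - p * ((N / p : ℕ) : ℝ)) - (x - N) / (p - 1) - p * (s / (p - 1)) := by
    rw [hv]; field_simp; ring
  rw [e]
  have h3 : (s : ℝ) / (p - 1) ≤ Real.log x / Real.log p + 1 := by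
    rw [div_le_iff₀ hp1]; exact hs2
  have h4 : 0 ≤ (s : ℝ) / (p - 1) := by positivity
  have h5 : (x - N) / ((p : ℝ) - 1) ≤ 1 := by rw [div_le_one hp1]; linarith
  have h6 : 0 ≤ (x - N) / ((p : ℝ) - 1) := div_nonneg (by linarith) hp1.le
  have h7 := mul_le_mul_of_nonneg_left h3 (by linarith : (0 : ℝ) ≤ p)
  have h8 : 0 ≤ (p : ℝ) * (s / (p - 1)) := by positivity
  have h9 : 0 ≤ (p : ℝ) * (Real.log x / Real.log p) :=
    mul_nonneg (by linarith) (div_nonneg (Real.log_nonneg hx) hlp.le)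
  rw [abs_le]
  constructor <;> linarith

theorem mul_log_div_log_add_two_le {y : ℝ} {p : ℕ} (hp : p.Prime) (hpy : p ≤ y) :
    p * (Real.log (y ^ 2) / Real.log p + 2) ≤ 8 * y + 8 * (√y * Real.log y) := by
  have hp2 : (2 : ℝ) ≤ p := by exact_mod_cast hp.two_le
  have hlp : 1 / 2 ≤ Real.log p := by
    have := Real.log_le_log (by norm_num) hp2
    linarith [Real.log_two_gt_d9]
  have hly : Real.log p ≤ Real.log y := Real.log_le_log (by linarith) hpy
  have hy0 : 0 < y := by linarith
  rw [Real.log_pow]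
  push_cast
  have h1 : 1 ≤ Real.log y / Real.log p := by rw [one_le_div (by linarith)]; exact hly
  have h2 : p * (2 * Real.log y / Real.log p + 2) ≤ 4 * (p * (Real.log y / Real.log p)) := by
    rw [mul_div_assoc]
    nlinarith
  refine h2.trans ?_
  -- For small `p` a factor `log y` is lost but `p ≤ √y` compensates; for large `p` the ratio of
  -- logarithms is at most 2.
  rcases le_or_gt (p : ℝ) (√y) with h | h
  · have h3 : Real.log y / Real.log p ≤ 2 * Real.log y := by
      rw [div_le_iff₀ (by linarith)]
      nlinarith
    have h4 : p * (Real.log y / Real.log p) ≤ √y * (2 * Real.log y) :=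
      mul_le_mul h h3 (by linarith) (Real.sqrt_nonneg y)
    linarith
  · have h3 : Real.log y / Real.log p ≤ 2 := by
      rw [div_le_iff₀ (by linarith)]
      have h5 := Real.log_le_log (Real.sqrt_pos.2 hy0) h.le
      rw [Real.log_sqrt hy0.le] at h5
      linarith
    have h4 : p * (Real.log y / Real.log p) ≤ y * 2 :=
      mul_le_mul hpy h3 (by linarith) hy0.le
    have h5 : 0 ≤ √y * Real.log y := mul_nonneg (Real.sqrt_nonneg y) (by linarith)
    linarith

theorem sum_mul_log_div_log_add_two_le {y : ℝ} (hy : 1 < y) :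
    ∑ p ∈ Nat.primesLE ⌊y⌋₊, p * (Real.log (y ^ 2) / Real.log p + 2) ≤
      300 * (y ^ 2 / Real.log y) := by
  have hL : 0 < Real.log y := Real.log_pos hy
  have hs : √y ^ 2 = y := Real.sq_sqrt (by linarith)
  have hs1 : 1 ≤ √y := Real.one_le_sqrt.2 hy.le
  have hsq := log_sq_le hy.le
  have hpi := Chebyshev.pi_le_log4_mul_div hy
  rw [← Nat.primesLE_card_eq_primeCounting, Real.log_sqrt (by linarith)] at hpi
  set c : ℝ := (#(Nat.primesLE ⌊y⌋₊) : ℝ) with hc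
  have hcy : c ≤ y := by
    refine le_trans ?_ (Nat.floor_le (by linarith : 0 ≤ y))
    rw [hc, Nat.cast_le, Nat.primesLE_eq_filter_Icc_one]
    exact (card_filter_le _ _).trans (by simp)
  have hl4 : Real.log 4 ≤ 2 := by
    have : Real.log 4 = 2 * Real.log 2 := by
      rw [show (4 : ℝ) = 2 ^ 2 by norm_num, Real.log_pow]; norm_num
    linarith [Real.log_two_lt_d9]
  have hslog : √y * Real.log y ≤ 4 * y := by
    have h1 : Real.log y ≤ 4 * √y := by
      refine (pow_le_pow_iff_left₀ hL.le (by positivity) two_ne_zero).1 ?_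
      rw [mul_pow, hs]
      nlinarith
    nlinarith
  have hpi' : c * Real.log y ≤ 8 * y := by
    have h1 : c ≤ (2 * Real.log 4 * y) / Real.log y + √y := by
      refine hpi.trans (le_of_eq ?_)
      field_simp
    have h2 := mul_le_mul_of_nonneg_right h1 hL.le
    rw [add_mul, div_mul_cancel₀ _ hL.ne'] at h2
    nlinarith
  have hslog2 : √y * (Real.log y) ^ 2 ≤ 16 * y := by nlinarith
  calc _ ≤ ∑ p ∈ Nat.primesLE ⌊y⌋₊, (8 * y + 8 * (√y * Real.log y)) :=
        sum_le_sum fun p hp => mul_log_div_log_add_two_le (Nat.prime_of_mem_primesLE hp)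
          ((Nat.le_floor_iff (by linarith)).1 (Nat.le_of_mem_primesLE hp))
    _ = c * (8 * y) + c * (8 * (√y * Real.log y)) := by
        rw [sum_const, nsmul_eq_mul]; ring
    _ ≤ _ := by
        -- The trivial bound `π(y) ≤ y` suffices here; Chebyshev is needed only for the term `8 *
        -- y`. Together they give `64 + 128 ≤ 300`.
        have h1 : c * (8 * (√y * Real.log y)) ≤ y * (8 * (√y * Real.log y)) :=
          mul_le_mul_of_nonneg_right hcy (by positivity)
        refine (add_le_add_right h1 _).trans ?_
        rw [← mul_div_assoc, le_div_iff₀ hL]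
        have h2 : c * Real.log y * (8 * y) ≤ 8 * y * (8 * y) :=
          mul_le_mul_of_nonneg_right hpi' (by linarith)
        have h3 : √y * (Real.log y) ^ 2 * (8 * y) ≤ 16 * y * (8 * y) :=
          mul_le_mul_of_nonneg_right hslog2 (by linarith)
        nlinarith

theorem sum_B_eq_sum_primesLE_sqrt {x : ℝ} (hx : 1 ≤ x) :
    ∑ n ∈ Icc 1 ⌊x⌋₊, B n = ∑ p ∈ Nat.primesLE ⌊√x⌋₊,
      (p : ℝ) * ((⌊x⌋₊.factorial.factorization p : ℝ) - ((⌊x⌋₊ / p : ℕ) : ℝ)) := by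
  rw [sum_B_eq_sum_primesLE]
  symm
  have hsx : √x ≤ x := Real.sqrt_le_self_iff.2 (Or.inr hx)
  refine sum_subset (fun p hp => ?_) fun p hp hp' => ?_
  · rw [Nat.mem_primesLE] at hp ⊢
    exact ⟨hp.1.trans (Nat.floor_le_floor hsx), hp.2⟩
  · have hpp := Nat.prime_of_mem_primesLE hp
    have h1 : ⌊√x⌋₊ < p := by
      by_contra hc
      exact hp' (Nat.mem_primesLE.2 ⟨not_lt.1 hc, hpp⟩)
    have h2 : ⌊x⌋₊ < p ^ 2 := by
      rw [Nat.floor_lt (by linarith)]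
      push_cast
      exact (Real.sqrt_lt' (by exact_mod_cast hpp.pos)).1 ((Nat.floor_lt (Real.sqrt_nonneg x)).1 h1)
    rw [factorization_factorial_eq_div hpp h2, sub_self, mul_zero]

theorem exists_abs_sum_B_sub_le : ∃ C : ℝ, ∀ x : ℝ, 2 ≤ x →
    |(∑ n ∈ Icc 1 ⌊x⌋₊, B n) - (x * Real.log (Real.log (√x)) + F * x)| ≤
      C * (x / Real.log x) := by
  obtain ⟨K, hK, h⟩ := exists_abs_sum_one_div_prime_sub_one_sub_le
  refine ⟨2 * (300 + K), fun x hx => ?_⟩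
  have hx0 : 0 < x := by linarith
  have hL : 0 < Real.log x := Real.log_pos (by linarith)
  have hs : √x ^ 2 = x := Real.sq_sqrt hx0.le
  have hy : 1 < √x := Real.lt_sqrt_of_sq_lt (by linarith)
  have hly : Real.log (√x) = Real.log x / 2 := Real.log_sqrt hx0.le
  have h1 := h (√x) hy
  have h2 := sum_mul_log_div_log_add_two_le hy
  rw [hs] at h2
  rw [sum_B_eq_sum_primesLE_sqrt (by linarith)]
  set P := Nat.primesLE ⌊√x⌋₊
  set S := ∑ p ∈ P, (p : ℝ) * ((⌊x⌋₊.factorial.factorization p : ℝ) - ((⌊x⌋₊ / p : ℕ) : ℝ))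
  have h3 : |S - x * ∑ p ∈ P, 1 / ((p : ℝ) - 1)| ≤ 300 * (x / Real.log (√x)) := by
    rw [mul_sum, ← sum_sub_distrib]
    refine (abs_sum_le_sum_abs _ _).trans (le_trans (sum_le_sum fun p hp => ?_) h2)
    rw [mul_one_div]
    exact abs_factorization_factorial_sub_le (by linarith) (Nat.prime_of_mem_primesLE hp)
  have h4 : |x * ∑ p ∈ P, 1 / ((p : ℝ) - 1) - (x * Real.log (Real.log (√x)) + F * x)| ≤
      x * (K / Real.log (√x)) := by
    have e : x * ∑ p ∈ P, 1 / ((p : ℝ) - 1) - (x * Real.log (Real.log (√x)) + F * x) =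
      x * (∑ p ∈ P, 1 / ((p : ℝ) - 1) - (Real.log (Real.log (√x)) + F)) := by ring
    rw [e, abs_mul, abs_of_pos hx0]
    exact mul_le_mul_of_nonneg_left h1 hx0.le
  refine (abs_sub_le _ _ _).trans ((add_le_add h3 h4).trans (le_of_eq ?_))
  rw [hly]
  field_simp

/-! ### Numerical value of `F` -/

theorem abs_harmonic_sub_log_sub_eulerMascheroni_le {n : ℕ} (hn : 1 ≤ n) :
    |(harmonic n : ℝ) - Real.log n - 1 / (2 * n) - Real.eulerMascheroniConstant| ≤
      1 / (8 * (n : ℝ) ^ 2) := by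
  have hinv : Tendsto (fun n : ℕ => 1 / (n : ℝ)) atTop (𝓝 0) := tendsto_one_div_atTop_nhds_zero_nat
  obtain ⟨c, hc⟩ := exists_abs_sub_le_of_telescoping
    (w := fun n : ℕ => (harmonic n : ℝ) - Real.log n - 1 / (2 * n))
    (b := fun n : ℕ => 1 / (8 * (n : ℝ) ^ 2)) (C := 1) (m := 1) zero_le_one
    (fun n => by positivity) (by
      have := (hinv.mul hinv).const_mul (1 / 8)
      simp only [mul_zero] at this
      refine this.congr fun n => ?_
      rw [← one_div_mul_one_div, sq, ← one_div_mul_one_div]) (by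
      intro n hn
      have hn0 : (0 : ℝ) < n := by exact_mod_cast hn
      -- The increment is the trapezoidal error for `log ((n+1)/n)`, and this `t` makes `(1+t)/(1-t)
      -- = (n+1)/n`, so the series of `log ((1+t)/(1-t))` bounds it on both sides.
      set t : ℝ := 1 / (2 * n + 1) with ht
      have ht0 : 0 ≤ t := by positivity
      have ht1 : t < 1 := by
        rw [ht, div_lt_one (by positivity)]; linarith
      have hq : (1 + t) / (1 - t) = (n + 1) / n := by
        have : (1 : ℝ) - t = 2 * n / (2 * n + 1) := by rw [ht]; field_simp; ring
        rw [this, ht]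
        field_simp
        ring
      have h1 := Real.sum_range_le_log_div ht0 ht1 1
      have h2 := Real.log_div_le_sum_range_add ht0 ht1 1
      simp only [range_one, sum_singleton, hq, Nat.cast_zero, mul_zero, zero_add, mul_one,
        pow_one, div_one] at h1 h2
      rw [Real.log_div (by positivity) hn0.ne'] at h1 h2
      have e1 : t + t ^ (2 + 1) / (1 - t ^ 2) = (1 / n + 1 / (n + 1)) / 4 := by
        have : (1 : ℝ) - t ^ 2 = 4 * n * (n + 1) / (2 * n + 1) ^ 2 := by
          rw [ht]; field_simp; ring
        rw [this, ht, one_div_pow]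
        field_simp
        ring
      have e2 : (1 / (n : ℝ) + 1 / (n + 1)) / 2 - 2 * t ≤
          1 / (8 * (n : ℝ) ^ 2) - 1 / (8 * ((n : ℝ) + 1) ^ 2) := by
        have a1 : (1 / (n : ℝ) + 1 / (n + 1)) / 2 - 2 * t =
            1 / (2 * n * (n + 1) * (2 * n + 1)) := by
          rw [ht]; field_simp; ring
        have a2 : 1 / (8 * (n : ℝ) ^ 2) - 1 / (8 * ((n : ℝ) + 1) ^ 2) =
            (2 * n + 1) / (8 * n ^ 2 * (n + 1) ^ 2) := by
          field_simp; ring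
        rw [a1, a2, div_le_div_iff₀ (by positivity) (by positivity)]
        have : 0 ≤ (n : ℝ) * (n + 1) := by positivity
        nlinarith
      rw [e1] at h2
      rw [harmonic_succ]
      push_cast
      have e3 : (harmonic n : ℝ) + ((n : ℝ) + 1)⁻¹ - Real.log (n + 1) - 1 / (2 * (n + 1)) -
          (harmonic n - Real.log n - 1 / (2 * n)) =
          (1 / n + 1 / (n + 1)) / 2 - (Real.log (n + 1) - Real.log n) := by
        field_simp; ring
      rw [e3, abs_le]
      constructor <;> linarith)
  have hlim : Tendsto (fun n : ℕ => (harmonic n : ℝ) - Real.log n - 1 / (2 * n)) atTop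
      (𝓝 Real.eulerMascheroniConstant) := by
    have := Real.tendsto_harmonic_sub_log.sub (hinv.const_mul (1 / 2))
    simp only [mul_zero, sub_zero] at this
    refine this.congr fun n => ?_
    rw [← one_div_mul_one_div]
  have hlim' : Tendsto (fun n : ℕ => (harmonic n : ℝ) - Real.log n - 1 / (2 * n)) atTop (𝓝 c) := by
    rw [tendsto_iff_norm_sub_tendsto_zero]
    have hz : Tendsto (fun n : ℕ => 1 / (n : ℝ)) atTop (𝓝 0) := hinv
    refine squeeze_zero' (Eventually.of_forall fun _ => norm_nonneg _) ?_ hz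
    filter_upwards [eventually_ge_atTop 1] with n hn
    have hn0 : (1 : ℝ) ≤ n := by exact_mod_cast hn
    refine (hc n hn).trans ?_
    rw [one_mul]
    exact one_div_le_one_div_of_le (by linarith) (by nlinarith)
  have := hc n hn
  rwa [one_mul, tendsto_nhds_unique hlim' hlim] at this

theorem tsum_log_one_sub_prime_inv_sq :
    ∑' p : Nat.Primes, Real.log (1 - 1 / ((p : ℕ) : ℝ) ^ 2) = -Real.log (Real.pi ^ 2 / 6) := by
  have h := riemannZeta_eulerProduct_exp_log (s := 2) (by norm_num)
  have h1 : ∀ p : Nat.Primes, -Complex.log (1 - (p : ℂ) ^ (-2 : ℂ)) =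
      ((-Real.log (1 - 1 / ((p : ℕ) : ℝ) ^ 2) : ℝ) : ℂ) := fun p => by
    have hp2 : (2 : ℝ) ≤ (p : ℕ) := by exact_mod_cast p.2.two_le
    have h2 : 0 ≤ 1 - 1 / ((p : ℕ) : ℝ) ^ 2 := by
      rw [sub_nonneg, div_le_one (by positivity)]
      nlinarith
    rw [Complex.ofReal_neg, Complex.ofReal_log h2, Complex.cpow_neg,
      show (2 : ℂ) = ((2 : ℕ) : ℂ) by norm_num, Complex.cpow_natCast]
    push_cast
    rw [one_div]
  simp_rw [h1] at h
  rw [← Complex.ofReal_tsum, riemannZeta_two, ← Complex.ofReal_exp] at h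
  have h3 : Real.exp (∑' p : Nat.Primes, -Real.log (1 - 1 / ((p : ℕ) : ℝ) ^ 2)) =
      Real.pi ^ 2 / 6 := by exact_mod_cast h
  rw [← h3, Real.log_exp, tsum_neg, neg_neg]

/-- The terms of the series for `F` with the main part of an Euler product for `ζ(2)` removed. -/
noncomputable def acceleratedTerm (n : ℕ) : ℝ := natTerm n + Real.log (1 - 1 / (n : ℝ) ^ 2) / 2

theorem acceleratedTerm_eq {n : ℕ} (hn : 2 ≤ n) :
    acceleratedTerm n = 1 / ((n : ℝ) - 1) +
      (3 * Real.log (1 - 1 / n) + Real.log (1 + 1 / n)) / 2 := by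
  have hn2 : (2 : ℝ) ≤ n := by exact_mod_cast hn
  have h1 : 1 / (n : ℝ) ≤ 1 / 2 := one_div_le_one_div_of_le (by norm_num) hn2
  have h2 : 0 < 1 / (n : ℝ) := by positivity
  have e : 1 - 1 / (n : ℝ) ^ 2 = (1 - 1 / n) * (1 + 1 / n) := by field_simp; ring
  rw [acceleratedTerm, natTerm, e, Real.log_mul (by linarith) (by linarith)]
  ring

/-- With `u = 1/n` the `u^2` terms cancel and the leading term is `(2/3) u^3`; `0.8` leaves room for
the higher orders when `u ≤ 1/101`. -/
theorem acceleratedTerm_bounds {n : ℕ} (hn : 101 ≤ n) :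
    0 ≤ acceleratedTerm n ∧ acceleratedTerm n ≤ 0.8 * (1 / (n : ℝ)) ^ 3 := by
  have hn1 : (101 : ℝ) ≤ n := by exact_mod_cast hn
  rw [acceleratedTerm_eq (by omega)]
  have hr : 1 / ((n : ℝ) - 1) = (1 / n) / (1 - 1 / n) := by
    have : (n : ℝ) - 1 ≠ 0 := by linarith
    field_simp
  have hu : 1 / (n : ℝ) ≤ 1 / 101 := one_div_le_one_div_of_le (by norm_num) hn1
  have hu0 : 0 < 1 / (n : ℝ) := by positivity
  rw [hr]
  generalize 1 / (n : ℝ) = u at *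
  have h1 := Real.abs_log_sub_add_sum_range_le (x := u) (by rw [abs_of_pos hu0]; linarith) 3
  have h2 := Real.abs_log_sub_add_sum_range_le (x := -u)
    (by rw [abs_neg, abs_of_pos hu0]; linarith) 3
  rw [abs_neg] at h2
  rw [abs_of_pos hu0] at h1 h2
  simp only [sum_range_succ, sum_range_zero, sub_neg_eq_add] at h1 h2
  norm_num at h1 h2
  have h3 : u ^ 4 / (1 - u) ≤ 2 * u ^ 4 := by
    rw [div_le_iff₀ (by linarith)]
    nlinarith [pow_pos hu0 4]
  have h4 : u / (1 - u) = u + u ^ 2 + u ^ 3 + u ^ 4 / (1 - u) := by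
    have : 1 - u ≠ 0 := by linarith
    field_simp; ring
  have h5 : 0 ≤ u ^ 4 / (1 - u) := div_nonneg (by positivity) (by linarith)
  have h6 : u ^ 4 ≤ u ^ 3 / 101 := by
    have := mul_le_mul_of_nonneg_left hu (pow_pos hu0 3).le
    calc u ^ 4 = u ^ 3 * u := by ring
      _ ≤ u ^ 3 * (1 / 101) := this
      _ = _ := by ring
  have h7 := pow_pos hu0 3
  rw [h4]
  rw [abs_le] at h1 h2
  constructor <;> nlinarith

theorem F_bounds_acceleratedTerm :
    Real.eulerMascheroniConstant + ∑ p ∈ Nat.primesLE 100, acceleratedTerm p +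
        Real.log (Real.pi ^ 2 / 6) / 2 ≤ F ∧
      F ≤ Real.eulerMascheroniConstant + ∑ p ∈ Nat.primesLE 100, acceleratedTerm p +
        Real.log (Real.pi ^ 2 / 6) / 2 + 0.00004 := by
  obtain ⟨hs, h1, h2⟩ := summable_primes_and_tsum_bounds (g := acceleratedTerm)
    -- Its drop is `0.8 / (m (m+1) (m+2))`, which is at least `0.8 / (m+1)^3`; its value at 100 is
    -- below `0.00004`.
    (b := fun m => 0.4 / ((m : ℝ) * (m + 1))) (n := 100) (fun m => by positivity)
    (fun m hm => by
      have : (0 : ℝ) < m := by exact_mod_cast (by omega : 0 < m)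
      push_cast
      exact div_le_div_of_nonneg_left (by norm_num) (by positivity) (by nlinarith))
    (fun m hm _ => by
      have hm0 : (0 : ℝ) < m := by exact_mod_cast (by omega : 0 < m)
      obtain ⟨a1, a2⟩ := acceleratedTerm_bounds (n := m + 1) (by omega)
      refine ⟨a1, a2.trans ?_⟩
      push_cast
      have e : 0.4 / ((m : ℝ) * (m + 1)) - 0.4 / ((m + 1 : ℝ) * (m + 1 + 1)) =
          0.8 * (1 / ((m : ℝ) * (m + 1) * (m + 2))) := by
        field_simp; ring
      rw [e, one_div_pow]
      refine mul_le_mul_of_nonneg_left ?_ (by norm_num)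
      exact one_div_le_one_div_of_le (by positivity) (by nlinarith))
  have ht : Summable term := (summable_term_and_tsum_bounds le_rfl).1
  have hlog : Summable fun p : Nat.Primes => Real.log (1 - 1 / ((p : ℕ) : ℝ) ^ 2) := by
    refine ((hs.sub ht).mul_left 2).congr fun p => ?_
    simp only [acceleratedTerm, natTerm, term]
    ring
  have hz := tsum_log_one_sub_prime_inv_sq
  have hacc : ∑' p : Nat.Primes, acceleratedTerm p =
      ∑' p, term p - Real.log (Real.pi ^ 2 / 6) / 2 := by
    have : ∑' p : Nat.Primes, acceleratedTerm p =
        ∑' p, (term p + Real.log (1 - 1 / ((p : ℕ) : ℝ) ^ 2) / 2) := rfl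
    rw [this, ht.tsum_add (hlog.div_const 2), tsum_div_const, hz]
    ring
  rw [hacc] at h1 h2
  rw [F]
  norm_num at h2
  constructor <;> linarith

theorem primesLE_hundred : Nat.primesLE 100 = {2, 3, 5, 7, 11, 13, 17, 19, 23, 29, 31, 37, 41, 43,
    47, 53, 59, 61, 67, 71, 73, 79, 83, 89, 97} := by
  decide +kernel

theorem harmonic_bounds :
    (5.433147 : ℝ) ≤ (harmonic 128 : ℝ) ∧ (harmonic 128 : ℝ) ≤ 5.4331471 := by
  have h : (5.433147 : ℚ) ≤ harmonic 128 ∧ harmonic 128 ≤ (5.4331471 : ℚ) := by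
    simp only [harmonic, sum_range_succ, sum_range_zero]
    norm_num
  constructor
  · have := (Rat.cast_le (K := ℝ)).2 h.1
    push_cast at this
    exact this
  · have := (Rat.cast_le (K := ℝ)).2 h.2
    push_cast at this
    exact this

theorem sum_acceleratedTerm_bounds :
    (2.574145 : ℝ) - 0.0745459 / 2 - 3 * Real.log 2 ≤
      ∑ p ∈ Nat.primesLE 100, acceleratedTerm p + Real.log (Real.pi ^ 2 / 6) / 2 ∧
    ∑ p ∈ Nat.primesLE 100, acceleratedTerm p + Real.log (Real.pi ^ 2 / 6) / 2 ≤
      2.5741451 - 0.0745424 / 2 - 3 * Real.log 2 := by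
  set q : ℝ := ∏ p ∈ Nat.primesLE 100, ((1 - 1 / (p : ℝ)) ^ 3 * (1 + 1 / p)) with hq
  have hfac : ∀ p ∈ Nat.primesLE 100, (0 : ℝ) < 1 - 1 / p ∧ (0 : ℝ) < 1 + 1 / p := fun p hp => by
    have hp2 : (2 : ℝ) ≤ p := by exact_mod_cast Nat.two_le_of_mem_primesLE hp
    have h1 : 1 / (p : ℝ) ≤ 1 / 2 := one_div_le_one_div_of_le (by norm_num) hp2
    have h2 : 0 < 1 / (p : ℝ) := by positivity
    exact ⟨by linarith, by linarith⟩
  have hlogq : Real.log q = ∑ p ∈ Nat.primesLE 100,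
      (3 * Real.log (1 - 1 / p) + Real.log (1 + 1 / p)) := by
    rw [hq, Real.log_prod fun p hp =>
      (mul_pos (pow_pos (hfac p hp).1 3) (hfac p hp).2).ne']
    refine sum_congr rfl fun p hp => ?_
    rw [Real.log_mul (pow_pos (hfac p hp).1 3).ne' (hfac p hp).2.ne', Real.log_pow]
    norm_num
  have hq0 : 0 < q := prod_pos fun p hp => mul_pos (pow_pos (hfac p hp).1 3) (hfac p hp).2
  have hsum : ∑ p ∈ Nat.primesLE 100, acceleratedTerm p =
      ∑ p ∈ Nat.primesLE 100, 1 / ((p : ℝ) - 1) + Real.log q / 2 := by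
    rw [hlogq, sum_div, ← sum_add_distrib]
    exact sum_congr rfl fun p hp => acceleratedTerm_eq (Nat.two_le_of_mem_primesLE hp)
  have hpi0 : 0 < Real.pi ^ 2 / 6 := by positivity
  -- All logarithms are merged into one. The factor `64 = 2^6` brings its argument near `0.928`,
  -- where six Taylor terms suffice, at the price of `3 log 2`.
  have hcomb : Real.log (64 * q * (Real.pi ^ 2 / 6)) =
      6 * Real.log 2 + Real.log q + Real.log (Real.pi ^ 2 / 6) := by
    rw [Real.log_mul (by positivity) hpi0.ne', Real.log_mul (by norm_num) hq0.ne',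
      show (64 : ℝ) = 2 ^ 6 by norm_num, Real.log_pow]
    norm_num
  have hS : (2.574145 : ℝ) ≤ ∑ p ∈ Nat.primesLE 100, 1 / ((p : ℝ) - 1) ∧
      ∑ p ∈ Nat.primesLE 100, 1 / ((p : ℝ) - 1) ≤ (2.5741451 : ℝ) := by
    rw [primesLE_hundred]
    norm_num
  have hqb : (0.564257 : ℝ) ≤ 64 * q ∧ 64 * q ≤ 0.564258 := by
    rw [hq, primesLE_hundred]
    norm_num
  have hp1 := Real.pi_gt_d6
  have hp2 := Real.pi_lt_d6
  have hpl : (1.644933 : ℝ) ≤ Real.pi ^ 2 / 6 := by nlinarith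
  have hpu : Real.pi ^ 2 / 6 ≤ (1.644936 : ℝ) := by nlinarith
  have hyl : (0.928165 : ℝ) ≤ 64 * q * (Real.pi ^ 2 / 6) := by nlinarith
  have hyu : 64 * q * (Real.pi ^ 2 / 6) ≤ (0.928168 : ℝ) := by nlinarith
  have hl1 := Real.log_le_log (by norm_num) hyl
  have hl2 := Real.log_le_log (by positivity) hyu
  have ha := Real.abs_log_sub_add_sum_range_le (x := 1 - 0.928165) (by norm_num [abs_of_pos]) 6
  have hb := Real.abs_log_sub_add_sum_range_le (x := 1 - 0.928168) (by norm_num [abs_of_pos]) 6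
  rw [abs_le, sub_sub_cancel, abs_of_pos (by norm_num)] at ha hb
  simp only [sum_range_succ, sum_range_zero] at ha hb
  norm_num at ha hb hl1 hl2 ⊢
  rw [hsum]
  constructor <;> linarith

theorem F_bounds : (1.0346 : ℝ) < F ∧ F < (1.0347 : ℝ) := by
  obtain ⟨h1, h2⟩ := F_bounds_acceleratedTerm
  obtain ⟨h3, h4⟩ := sum_acceleratedTerm_bounds
  obtain ⟨h5, h6⟩ := harmonic_bounds
  -- Since `128 = 2^7`, the only logarithm entering the estimate of `γ` is again `log 2`.
  have h7 := abs_harmonic_sub_log_sub_eulerMascheroni_le (n := 128) (by norm_num)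
  have h8 : Real.log ((128 : ℕ) : ℝ) = 7 * Real.log 2 := by
    rw [show ((128 : ℕ) : ℝ) = 2 ^ 7 by norm_num, Real.log_pow]
    norm_num
  rw [h8, abs_le] at h7
  have h9 := Real.log_two_gt_d9
  have h10 := Real.log_two_lt_d9
  norm_num at h1 h2 h3 h4 h5 h6 h7 h9 h10 ⊢
  constructor <;> linarith

end AlladiErdos

theorem theorem7 :
    Summable AlladiErdos.term ∧
    (1.0346 : ℝ) < AlladiErdos.F ∧ AlladiErdos.F < (1.0347 : ℝ) ∧
    ∃ C : ℝ, ∀ x : ℝ, 2 ≤ x →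
      |(∑ n ∈ Finset.Icc 1 ⌊x⌋₊, AlladiErdos.B n) -
          (x * Real.log (Real.log (Real.sqrt x)) + AlladiErdos.F * x)| ≤
        C * (x / Real.log x) :=
  ⟨(AlladiErdos.summable_term_and_tsum_bounds le_rfl).1, AlladiErdos.F_bounds.1,
    AlladiErdos.F_bounds.2, AlladiErdos.exists_abs_sum_B_sub_le⟩
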